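/- Let $\mathbb{T}=(\Omega,V,E)$ be an algebraic theory: $\Omega$ is a set of finitary operation symbols, and $E$ is a set of equations between $\Omega$-terms in the variables $V$. Suppose that $\mathbb{T}$ is pointed, i.e. it has a constant $0\in\Omega$ and every closed term equals $0$ in every $\mathbb{T}$-algebra. Suppose also that there are binary (basic or derived) operations $+$ and $-$ of $\mathbb{T}$ satisfying, in all $\mathbb{T}$-algebras, $$x+0=x,\qquad 0+x=x,\qquad (x+y)-y=x,\qquad (x-y)+y=x .$$ Let $\mathbf{Top}^{\mathbb{T}}$ be the category of topological $\mathbb{T}$-algebras (topological spaces with continuous operations satisfying $E$) and continuous homomorphisms. For an object $B$, let $\mathbf{Pt}_B$ be the category of points over $B$: triples $(A,\ p\colon A\to B,\ s\colon B\to A)$ with $ps=1_B$, with morphisms commuting with $p$ and $s$. Let $U^B\colon\mathbf{Pt}_B\to\mathbf{Top}^{\mathbb{T}}$, $(A,p,s)\mapsto\ker p$, be the kernel functor, let $F^B\colon X\mapsto(X+B,[0,1],\iota_B)$ be its left adjoint ($X+B$ the coproduct in $\mathbf{Top}^{\mathbb{T}}$), and let $T^B=U^BF^B$ be the induced monad,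 so that $T^B(X)=\ker([0,1]\colon X+B\to B)$. A semidirect product $(X,\xi)\rtimes B$ of a $T^B$-algebra $\xi\colon T^B(X)\to X$ with $B$ is a point over $B$ whose image under the comparison functor $\mathbf{Pt}_B\to(\mathbf{Top}^{\mathbb{T}})^{T^B}$ is isomorphic to $(X,\xi)$. Then: 1. $\mathbf{Top}^{\mathbb{T}}$ has semidirect products: for every $B$ the comparison functor $\mathbf{Pt}_B\to(\mathbf{Top}^{\mathbb{T}})^{T^B}$ is an equivalence, i.e. $U^B$ is monadic. In particular $(X,\xi)\rtimes B$ exists and is unique up to isomorphism in $\mathbf{Pt}_B$. 2. For every object $B$ and every $T^B$-algebra $(X,\xi)$, the space $X\times B$ with the product topology and the operations $$\omega\big((x_1,b_1),\dots,(x_n,b_n)\big)=\Big(\xi\big(\omega(x_1+b_1,\dots,x_n+b_n)-\omega(b_1,\dots,b_n)\big),\ \omega(b_1,\dots,b_n)\Big)$$ for each $n$-ary $\omega\in\Omega$, $x_i\in X$, $b_i\in B$ (the argument of $\xi$ being computed in $X+B$, where it lies in $T^B(X)$), is a topological $\mathbb{T}$-algebra. Together with the projection $(x,b)\mapsto b$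 and the section $b\mapsto(0,b)$ it is a point over $B$, and this point is the semidirect product $(X,\xi)\rtimes B$: the map $x\mapsto(x,0)$ is an isomorphism of $T^B$-algebras from $(X,\xi)$ to its image under the comparison functor, and a point over $B$ is a semidirect product of $(X,\xi)$ with $B$ if and only if it is isomorphic to it in $\mathbf{Pt}_B$. -/

import Mathlib

open CategoryTheory

universe u v

/-! ## Algebraic theories and their topological algebras -/

namespace TopologicalVariety

/-- The first-order language with function symbols `Op n` of arity `n` and no relation symbols. -/
abbrev opLanguage (Op : ℕ → Type u) : FirstOrder.Language.{u, 0} := ⟨Op, fun _ => Empty⟩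

/-- A (finitary, one-sorted) algebraic theory: operation symbols with their arities, a set of
variables, and a set of equations between terms in these variables. -/
structure AlgTheory where
  Op : ℕ → Type u
  Var : Type u
  eqs : Set ((opLanguage Op).Term Var × (opLanguage Op).Term Var)

/-- The language of the operation symbols of a theory. -/
abbrev AlgTheory.lang (T : AlgTheory.{u}) : FirstOrder.Language.{u, 0} := opLanguage T.Op

/-- The algebra `A` satisfies all the equations of the theory. -/
def AlgTheory.Models (T : AlgTheory.{u}) (A : Type u) [T.lang.Structure A] : Prop :=
  ∀ e ∈ T.eqs, ∀ a : T.Var → A, e.1.realize a = e.2.realize a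

/-- The value of an operation symbol on a tuple. -/
abbrev AlgTheory.op (T : AlgTheory.{u}) {A : Type u} [T.lang.Structure A] {n : ℕ}
    (ω : T.Op n) (a : Fin n → A) : A :=
  FirstOrder.Language.Structure.funMap (L := T.lang) ω a

/-- An algebra structure given by its operations (there are no relation symbols). -/
abbrev AlgTheory.mkStructure (T : AlgTheory.{u}) {A : Type u}
    (o : ∀ {n : ℕ}, T.Op n → (Fin n → A) → A) : T.lang.Structure A where
  funMap := o
  RelMap := fun r => r.elim

/-- A pointed theory: there is a constant `zero`, and it is the only one, i.e. every closed term
has the value `zero` in every algebra of the theory. -/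
structure PointedTheory extends AlgTheory.{u} where
  zero : Op 0
  closed_eq_zero : ∀ t : (opLanguage Op).Term Empty, ∀ (A : Type u) [(opLanguage Op).Structure A],
    toAlgTheory.Models A →
      t.realize (Empty.elim : Empty → A) = toAlgTheory.op zero (Fin.elim0 : Fin 0 → A)

/-- A topological algebra over `T`: a topological space with continuous operations that satisfy
the equations of `T`. -/
structure TopAlg (T : AlgTheory.{u}) where
  carrier : Type u
  [top : TopologicalSpace carrier]
  [str : T.lang.Structure carrier]
  continuous_op : ∀ (n : ℕ) (ω : T.Op n), Continuous fun a : Fin n → carrier => T.op ω a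
  models : T.Models carrier

namespace TopAlg

variable {T : AlgTheory.{u}}

instance : CoeSort (TopAlg T) (Type u) := ⟨TopAlg.carrier⟩

instance (A : TopAlg T) : TopologicalSpace A := A.top

instance (A : TopAlg T) : T.lang.Structure A := A.str

/-- A morphism of topological algebras: a continuous homomorphism. -/
@[ext]
structure Hom (A B : TopAlg T) where
  toFun : A → B
  continuous_toFun : Continuous toFun
  map_op : ∀ (n : ℕ) (ω : T.Op n) (a : Fin n → A),
    toFun (T.op ω a) = T.op ω fun i => toFun (a i)

/-- The category of topological algebras over `T`. -/
instance : Category (TopAlg T) where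
  Hom := Hom
  id A := ⟨fun a => a, continuous_id, fun _ _ _ => rfl⟩
  comp f g := ⟨fun a => g.toFun (f.toFun a), g.continuous_toFun.comp f.continuous_toFun,
    fun n ω a => by rw [f.map_op, g.map_op]⟩

instance (A B : TopAlg T) : CoeFun (A ⟶ B) fun _ => A → B := ⟨Hom.toFun⟩

theorem hom_ext {A B : TopAlg T} {f g : A ⟶ B} (h : ∀ a, f a = g a) : f = g :=
  Hom.ext (funext h)

@[simp] theorem id_apply (A : TopAlg T) (a : A) : (𝟙 A : A ⟶ A) a = a := rfl

@[simp] theorem comp_apply {A B C : TopAlg T} (f : A ⟶ B) (g : B ⟶ C) (a : A) :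
    (f ≫ g) a = g (f a) := rfl

end TopAlg

theorem realize_map (T : AlgTheory.{u}) {A B : Type u} [T.lang.Structure A] [T.lang.Structure B]
    (f : A → B) (hf : ∀ (n : ℕ) (ω : T.Op n) (a : Fin n → A),
      f (T.op ω a) = T.op ω fun i => f (a i))
    {α : Type v} (t : T.lang.Term α) (a : α → A) :
    f (t.realize a) = t.realize fun i => f (a i) := by
  induction t with
  | var => rfl
  | func ω ts ih =>
    simp only [FirstOrder.Language.Term.realize_func]
    exact (hf _ _ _).trans (congrArg _ (funext ih))

/-! ## Binary coproducts of topological algebras -/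

namespace TopAlg

variable {T : AlgTheory.{u}} (A B : TopAlg T)

/-- Two terms in the elements of `A` and `B` are identified when they have the same value in every
`T`-algebra `C` under all pairs of algebra homomorphisms `A → C`, `B → C`. -/
def coprodSetoid : Setoid (T.lang.Term (A ⊕ B)) where
  r s t := ∀ (C : Type u) [T.lang.Structure C], T.Models C → ∀ (f : A → C) (g : B → C),
    (∀ (n : ℕ) (ω : T.Op n) (a : Fin n → A), f (T.op ω a) = T.op ω fun i => f (a i)) →
    (∀ (n : ℕ) (ω : T.Op n) (b : Fin n → B), g (T.op ω b) = T.op ω fun i => g (b i)) →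
      s.realize (Sum.elim f g) = t.realize (Sum.elim f g)
  iseqv :=
    { refl := fun _ _ _ _ _ _ _ _ => rfl
      symm := fun h C _ hC f g hf hg => (h C hC f g hf hg).symm
      trans := fun h k C _ hC f g hf hg => (h C hC f g hf hg).trans (k C hC f g hf hg) }

/-- The underlying set of the coproduct: terms `t(a₁, …, aₙ, b₁, …, bₘ)` up to identification. -/
def CoprodCarrier : Type u := Quotient (coprodSetoid A B)

/-- The class of a term in the coproduct. -/
def coprodMk (t : T.lang.Term (A ⊕ B)) : CoprodCarrier A B := Quotient.mk (coprodSetoid A B) t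

/-- A representing term of an element of the coproduct. -/
noncomputable def coprodOut (x : CoprodCarrier A B) : T.lang.Term (A ⊕ B) := Quotient.out x

theorem coprodMk_out (x : CoprodCarrier A B) : coprodMk A B (coprodOut A B x) = x :=
  Quotient.out_eq x

/-- The operations of the coproduct: an operation symbol is applied formally to terms. -/
noncomputable instance coprodStructure : T.lang.Structure (CoprodCarrier A B) :=
  T.mkStructure fun ω x => coprodMk A B (FirstOrder.Language.Term.func ω fun i => coprodOut A B (x i))

theorem coprod_op_mk {n : ℕ} (ω : T.Op n) (t : Fin n → T.lang.Term (A ⊕ B)) :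
    T.op ω (fun i => coprodMk A B (t i)) = coprodMk A B (FirstOrder.Language.Term.func ω t) := by
  refine Quotient.sound fun C _ hC f g hf hg => ?_
  simp only [FirstOrder.Language.Term.realize_func]
  refine congrArg _ (funext fun i => ?_)
  exact Quotient.exact (coprodMk_out A B (coprodMk A B (t i))) C hC f g hf hg

theorem coprod_realize_mk {α : Type v} (s : T.lang.Term α) (t : α → T.lang.Term (A ⊕ B)) :
    s.realize (fun i => coprodMk A B (t i)) = coprodMk A B (s.subst t) := by
  induction s with
  | var => rfl
  | func ω ts ih =>
    simp only [FirstOrder.Language.Term.realize_func, FirstOrder.Language.Term.subst]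
    rw [← coprod_op_mk]
    exact congrArg _ (funext ih)

theorem coprod_models : T.Models (CoprodCarrier A B) := by
  intro e he a
  have ha : a = fun i => coprodMk A B (coprodOut A B (a i)) :=
    funext fun i => (coprodMk_out A B (a i)).symm
  rw [ha, coprod_realize_mk, coprod_realize_mk]
  refine Quotient.sound fun C _ hC f g hf hg => ?_
  rw [FirstOrder.Language.Term.realize_subst, FirstOrder.Language.Term.realize_subst]
  exact hC e he _

/-- The injection of `A`, as a function. -/
def coprodInl (a : A) : CoprodCarrier A B := coprodMk A B (FirstOrder.Language.Term.var (Sum.inl a))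

/-- The injection of `B`, as a function. -/
def coprodInr (b : B) : CoprodCarrier A B := coprodMk A B (FirstOrder.Language.Term.var (Sum.inr b))

/-- The topologies on the coproduct for which all operations and both injections are
continuous. -/
def coprodTopologies : Set (TopologicalSpace (CoprodCarrier A B)) :=
  {τ | (∀ (n : ℕ) (ω : T.Op n),
      @Continuous (Fin n → CoprodCarrier A B) (CoprodCarrier A B)
        (@Pi.topologicalSpace (Fin n) (fun _ => CoprodCarrier A B) fun _ => τ) τ fun x => T.op ω x) ∧
    @Continuous A (CoprodCarrier A B) _ τ (coprodInl A B) ∧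
    @Continuous B (CoprodCarrier A B) _ τ (coprodInr A B)}

/-- The topology of the coproduct: the finest one for which all operations and both injections
are continuous. -/
def coprodTopology : TopologicalSpace (CoprodCarrier A B) := sInf (coprodTopologies A B)

theorem coprod_continuous_op (n : ℕ) (ω : T.Op n) :
    @Continuous (Fin n → CoprodCarrier A B) (CoprodCarrier A B)
      (@Pi.topologicalSpace (Fin n) (fun _ => CoprodCarrier A B) fun _ => coprodTopology A B)
      (coprodTopology A B) fun x => T.op ω x := by
  refine continuous_sInf_rng.2 fun τ hτ => continuous_le_dom ?_ (hτ.1 n ω)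
  exact iInf_mono fun i => induced_mono (sInf_le hτ)

/-- The coproduct of two topological algebras. -/
noncomputable def coprod : TopAlg T where
  carrier := CoprodCarrier A B
  top := coprodTopology A B
  continuous_op := coprod_continuous_op A B
  models := coprod_models A B

/-- The injection of the first summand. -/
noncomputable def inl : A ⟶ coprod A B where
  toFun := coprodInl A B
  continuous_toFun := continuous_sInf_rng.2 fun _ hτ => hτ.2.1
  map_op n ω a := by
    refine Eq.trans ?_ (coprod_op_mk A B ω fun i => FirstOrder.Language.Term.var (Sum.inl (a i))).symm
    exact Quotient.sound fun C _ _ f g hf _ => hf n ω a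

/-- The injection of the second summand. -/
noncomputable def inr : B ⟶ coprod A B where
  toFun := coprodInr A B
  continuous_toFun := continuous_sInf_rng.2 fun _ hτ => hτ.2.2
  map_op n ω b := by
    refine Eq.trans ?_ (coprod_op_mk A B ω fun i => FirstOrder.Language.Term.var (Sum.inr (b i))).symm
    exact Quotient.sound fun C _ _ f g _ hg => hg n ω b

variable {A B}

/-- The map out of the coproduct, as a function: a term is evaluated in `C`. -/
def descFun {C : TopAlg T} (f : A ⟶ C) (g : B ⟶ C) : CoprodCarrier A B → C :=
  Quotient.lift (fun t => t.realize (Sum.elim f.toFun g.toFun)) fun _ _ h =>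
    h C C.models f.toFun g.toFun f.map_op g.map_op

theorem descFun_op {C : TopAlg T} (f : A ⟶ C) (g : B ⟶ C) (n : ℕ) (ω : T.Op n)
    (x : Fin n → CoprodCarrier A B) :
    descFun f g (T.op ω x) = T.op ω fun i => descFun f g (x i) := by
  have hx : x = fun i => coprodMk A B (coprodOut A B (x i)) :=
    funext fun i => (coprodMk_out A B (x i)).symm
  rw [hx, coprod_op_mk]
  rfl

/-- The morphism out of the coproduct determined by two morphisms. -/
noncomputable def desc {C : TopAlg T} (f : A ⟶ C) (g : B ⟶ C) : coprod A B ⟶ C where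
  toFun := descFun f g
  continuous_toFun := by
    refine continuous_iff_le_induced.2 (sInf_le ⟨fun n ω => ?_, ?_, ?_⟩)
    · letI : TopologicalSpace (CoprodCarrier A B) :=
        TopologicalSpace.induced (descFun f g) C.top
      refine continuous_induced_rng.2 ?_
      have h : (descFun f g ∘ fun x : Fin n → CoprodCarrier A B => T.op ω x) =
          (fun c : Fin n → C => T.op ω c) ∘ fun x i => descFun f g (x i) :=
        funext fun x => descFun_op f g n ω x
      rw [h]
      refine (C.continuous_op n ω).comp (continuous_pi fun i => ?_)
      exact continuous_induced_dom.comp (continuous_apply i)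
    · exact continuous_induced_rng.2 f.continuous_toFun
    · exact continuous_induced_rng.2 g.continuous_toFun
  map_op := descFun_op f g

@[simp] theorem desc_inl {C : TopAlg T} (f : A ⟶ C) (g : B ⟶ C) (a : A) :
    desc f g (inl A B a) = f a := rfl

@[simp] theorem desc_inr {C : TopAlg T} (f : A ⟶ C) (g : B ⟶ C) (b : B) :
    desc f g (inr A B b) = g b := rfl

theorem coprod_hom_ext {C : TopAlg T} {h k : coprod A B ⟶ C}
    (h₁ : ∀ a : A, h (inl A B a) = k (inl A B a)) (h₂ : ∀ b : B, h (inr A B b) = k (inr A B b)) :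
    h = k := by
  refine hom_ext fun x => ?_
  have key : ∀ t : T.lang.Term (A ⊕ B), h (coprodMk A B t) = k (coprodMk A B t) := by
    intro t
    induction t with
    | var i => cases i with
      | inl a => exact h₁ a
      | inr b => exact h₂ b
    | func ω ts ih =>
      rw [← coprod_op_mk]
      exact (h.map_op _ ω _).trans ((congrArg _ (funext ih)).trans (k.map_op _ ω _).symm)
  exact (congrArg h.toFun (coprodMk_out A B x)).symm.trans
    ((key _).trans (congrArg k.toFun (coprodMk_out A B x)))

/-- `coprod A B` is a coproduct of `A` and `B` in the category of topological algebras. -/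
noncomputable def coprodIsColimit : Limits.IsColimit (Limits.BinaryCofan.mk (inl A B) (inr A B)) :=
  Limits.BinaryCofan.IsColimit.mk _ (fun f g => desc f g) (fun _ _ => rfl) (fun _ _ => rfl)
    fun _ _ m h₁ h₂ => coprod_hom_ext
      (fun a => congrArg (fun φ : A ⟶ _ => φ a) h₁) (fun b => congrArg (fun φ : B ⟶ _ => φ b) h₂)

end TopAlg

/-! ## The category of points over an object -/

/-- A point over `B`: a split epimorphism `p : obj ⟶ B` with a chosen section `s`. -/
structure Pt {C : Type u} [Category.{v} C] (B : C) where
  obj : C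
  p : obj ⟶ B
  s : B ⟶ obj
  s_p : s ≫ p = 𝟙 B

namespace Pt

variable {C : Type u} [Category.{v} C] {B : C}

/-- A morphism of points over `B`: it commutes with the projections and with the sections. -/
@[ext]
structure Hom (P Q : Pt B) where
  hom : P.obj ⟶ Q.obj
  hom_p : hom ≫ Q.p = P.p
  s_hom : P.s ≫ hom = Q.s

/-- The category of points over `B`. -/
instance : Category (Pt B) where
  Hom := Hom
  id P := ⟨𝟙 P.obj, Category.id_comp _, Category.comp_id _⟩
  comp f g := ⟨f.hom ≫ g.hom, by rw [Category.assoc, g.hom_p, f.hom_p],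
    by rw [← Category.assoc, f.s_hom, g.s_hom]⟩
  id_comp f := Hom.ext (Category.id_comp f.hom)
  comp_id f := Hom.ext (Category.comp_id f.hom)
  assoc f g h := Hom.ext (Category.assoc f.hom g.hom h.hom)

end Pt

/-! ## Pointed theories: zero morphisms, kernels and the monad of a base object -/

/-- The category of topological algebras over a pointed theory. -/
abbrev PAlg (T : PointedTheory.{u}) : Type (u + 1) := TopAlg T.toAlgTheory

namespace PAlg

variable {T : PointedTheory.{u}}

/-- The value of the constant of a pointed theory in an algebra. -/
abbrev _root_.TopologicalVariety.PointedTheory.zeroOf (T : PointedTheory.{u}) (A : Type u)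
    [T.lang.Structure A] : A := T.op T.zero Fin.elim0

theorem op_zero {A : Type u} [T.lang.Structure A] (hA : T.Models A) {n : ℕ} (ω : T.Op n) :
    T.op ω (fun _ => T.zeroOf A) = T.zeroOf A := by
  refine Eq.trans ?_ (T.closed_eq_zero (FirstOrder.Language.Term.func ω fun _ =>
    FirstOrder.Language.Term.func T.zero Fin.elim0) A hA)
  simp only [FirstOrder.Language.Term.realize_func]
  exact congrArg _ (funext fun _ => congrArg _ (funext fun i => i.elim0))

theorem map_zero {A B : PAlg T} (f : A ⟶ B) : f (T.zeroOf A) = T.zeroOf B :=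
  (f.map_op 0 T.zero _).trans (congrArg _ (funext fun i => i.elim0))

/-- The zero morphism. -/
def zeroHom (A B : PAlg T) : A ⟶ B where
  toFun _ := T.zeroOf B
  continuous_toFun := continuous_const
  map_op _ ω _ := (op_zero B.models ω).symm

/-- The operations on the subalgebra of all `a` with `f a = 0`. -/
@[reducible]
def kerStructure {A B : PAlg T} (f : A ⟶ B) : T.lang.Structure {a : A // f a = T.zeroOf B} :=
  T.mkStructure fun ω a => ⟨T.op ω fun i => (a i).1, by
    rw [f.map_op, funext fun i => (a i).2, op_zero B.models]⟩

theorem ker_models {A B : PAlg T} (f : A ⟶ B) :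
    @AlgTheory.Models T.toAlgTheory {a : A // f a = T.zeroOf B} (kerStructure f) := by
  intro e he a
  refine Subtype.ext ?_
  have h : ∀ t : T.lang.Term T.Var,
      (@FirstOrder.Language.Term.realize _ _ (kerStructure f) _ a t).1 =
        t.realize fun i => (a i).1 := fun t =>
    @realize_map T.toAlgTheory _ _ (kerStructure f) _ Subtype.val (fun _ _ _ => rfl) _ t a
  rw [h, h]
  exact A.models e he _

/-- The kernel of `f : A ⟶ B`: the subalgebra of all `a` with `f a = 0`, with the subspace
topology. -/
def ker {A B : PAlg T} (f : A ⟶ B) : PAlg T where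
  carrier := {a : A // f a = T.zeroOf B}
  str := kerStructure f
  continuous_op n ω := Continuous.subtype_mk ((A.continuous_op n ω).comp
    (continuous_pi fun i => continuous_subtype_val.comp (continuous_apply i))) _
  models := ker_models f

/-- The inclusion of the kernel. -/
def kerι {A B : PAlg T} (f : A ⟶ B) : ker f ⟶ A where
  toFun := Subtype.val
  continuous_toFun := continuous_subtype_val
  map_op _ _ _ := rfl

/-- The morphism to a kernel determined by a morphism whose composite with `f` is zero. -/
def kerLift {A B K : PAlg T} (f : A ⟶ B) (g : K ⟶ A) (h : ∀ x, f (g x) = T.zeroOf B) :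
    K ⟶ ker f where
  toFun x := ⟨g x, h x⟩
  continuous_toFun := Continuous.subtype_mk g.continuous_toFun _
  map_op n ω a := Subtype.ext (g.map_op n ω a)

instance : Limits.HasZeroMorphisms (PAlg T) where
  zero A B := ⟨zeroHom A B⟩
  comp_zero _ _ := rfl
  zero_comp _ _ _ f := TopAlg.hom_ext fun _ => map_zero f

/-- `ker f` is a kernel of `f` in the category of topological algebras. -/
def kerIsLimit {A B : PAlg T} (f : A ⟶ B) :
    Limits.IsLimit (Limits.KernelFork.ofι (f := f) (kerι f) (TopAlg.hom_ext fun a => a.2)) :=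
  Limits.KernelFork.IsLimit.ofι _ _
    (fun g h => kerLift f g fun x => congrArg (fun φ : _ ⟶ B => φ x) h)
    (fun _ _ => rfl)
    (fun _ _ _ hm => TopAlg.hom_ext fun x =>
      Subtype.ext (congrArg (fun φ : _ ⟶ A => φ x) hm))

variable (B : PAlg T)

/-- The functor `U^B` from points over `B` to algebras, sending `(A, p, s)` to the kernel of
`p`. -/
def kerFunctor : Pt B ⥤ PAlg T where
  obj P := ker P.p
  map {P Q} f := kerLift Q.p (kerι P.p ≫ f.hom) fun x =>
    (congrArg (fun φ : P.obj ⟶ B => φ x.1) f.hom_p).trans x.2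
  map_id _ := rfl
  map_comp _ _ := rfl

/-- The point `[0, 1], ι_B : X + B ⇄ B`. -/
noncomputable def freePt (X : PAlg T) : Pt B where
  obj := TopAlg.coprod X B
  p := TopAlg.desc (zeroHom X B) (𝟙 B)
  s := TopAlg.inr X B
  s_p := rfl

/-- The functor `F^B` from algebras to points over `B`, sending `X` to `X + B`. -/
noncomputable def freeFunctor : PAlg T ⥤ Pt B where
  obj X := freePt B X
  map {X Y} f :=
    { hom := TopAlg.desc (f ≫ TopAlg.inl Y B) (TopAlg.inr Y B)
      hom_p := TopAlg.coprod_hom_ext (fun _ => rfl) (fun _ => rfl)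
      s_hom := rfl }
  map_id X := Pt.Hom.ext (TopAlg.coprod_hom_ext (fun _ => rfl) (fun _ => rfl))
  map_comp f g := Pt.Hom.ext (TopAlg.coprod_hom_ext (fun _ => rfl) (fun _ => rfl))

/-- The adjunction `F^B ⊣ U^B`: a morphism `f : X + B ⟶ A` of points corresponds to the
corestriction of `f ∘ ι_X` to the kernel. -/
noncomputable def adj : freeFunctor B ⊣ kerFunctor B :=
  Adjunction.mkOfHomEquiv
    { homEquiv := fun X P =>
        { toFun := fun f => kerLift P.p (TopAlg.inl X B ≫ f.hom) fun x =>
            congrArg (fun φ : TopAlg.coprod X B ⟶ B => φ (TopAlg.inl X B x)) f.hom_p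
          invFun := fun g =>
            { hom := TopAlg.desc (g ≫ kerι P.p) P.s
              hom_p := TopAlg.coprod_hom_ext (fun x => Subtype.property (g x))
                (fun b => congrArg (fun φ : B ⟶ B => φ b) P.s_p)
              s_hom := rfl }
          left_inv := fun f => Pt.Hom.ext (TopAlg.coprod_hom_ext (fun _ => rfl)
            (fun b => (congrArg (fun φ : B ⟶ P.obj => φ b) f.s_hom).symm))
          right_inv := fun _ => rfl }
      homEquiv_naturality_left_symm := fun _ _ =>
        Pt.Hom.ext (TopAlg.coprod_hom_ext (fun _ => rfl) (fun _ => rfl))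
      homEquiv_naturality_right := fun _ _ => rfl }

/-- The monad `T^B` induced by the adjunction `F^B ⊣ U^B`. -/
noncomputable abbrev pointMonad : Monad (PAlg T) := (adj B).toMonad

/-- The comparison functor from points over `B` to the algebras of the monad `T^B`. -/
noncomputable abbrev pointComparison : Pt B ⥤ (pointMonad B).Algebra := Monad.comparison (adj B)

end PAlg

/-! ## Semidirect products -/

/-- The category of topological `T`-algebras has semidirect products: for each `B`, the kernel
functor `U^B` is monadic. -/
def HasSemidirectProducts (T : PointedTheory.{u}) : Prop :=
  ∀ B : PAlg T, (PAlg.pointComparison B).IsEquivalence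

/-- The point `P` over `B` is a semidirect product of the `T^B`-algebra `X` with `B`: it
corresponds to `X` under the comparison functor. -/
def IsSemidirectProduct {T : PointedTheory.{u}} {B : PAlg T} (X : (PAlg.pointMonad B).Algebra)
    (P : Pt B) : Prop :=
  Nonempty ((PAlg.pointComparison B).obj P ≅ X)

/-- The value of a binary term. -/
abbrev PointedTheory.bin (T : PointedTheory.{u}) {A : Type u} [T.lang.Structure A]
    (t : T.lang.Term (Fin 2)) (x y : A) : A := t.realize ![x, y]

/-- The axioms `x + 0 = x`, `0 + x = x`, `(x + y) - y = x`, `(x - y) + y = x`, for two binary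
(basic or derived) operations of a pointed theory. -/
structure PointedTheory.LoopAxioms (T : PointedTheory.{u}) (plus minus : T.lang.Term (Fin 2)) :
    Prop where
  add_zero : ∀ (A : Type u) [T.lang.Structure A], T.Models A → ∀ x : A,
    T.bin plus x (T.zeroOf A) = x
  zero_add : ∀ (A : Type u) [T.lang.Structure A], T.Models A → ∀ x : A,
    T.bin plus (T.zeroOf A) x = x
  add_sub : ∀ (A : Type u) [T.lang.Structure A], T.Models A → ∀ x y : A,
    T.bin minus (T.bin plus x y) y = x
  sub_add : ∀ (A : Type u) [T.lang.Structure A], T.Models A → ∀ x y : A,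
    T.bin plus (T.bin minus x y) y = x

section Operations

variable {T : PointedTheory.{u}} {plus minus : T.lang.Term (Fin 2)}

theorem map_bin {A C : PAlg T} (f : A ⟶ C) (t : T.lang.Term (Fin 2)) (x y : A) :
    f (T.bin t x y) = T.bin t (f x) (f y) := by
  refine (realize_map T.toAlgTheory f.toFun f.map_op t _).trans (congrArg t.realize ?_)
  funext i
  fin_cases i <;> rfl

/-- The element `ω(x₁ + b₁, …, xₙ + bₙ) - ω(b₁, …, bₙ)` of the coproduct `X + B`. -/
noncomputable def twist (plus minus : T.lang.Term (Fin 2)) {X B : PAlg T} {n : ℕ} (ω : T.Op n)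
    (v : Fin n → X × B) : TopAlg.coprod X B :=
  T.bin minus
    (T.op ω fun i => T.bin plus (TopAlg.inl X B (v i).1) (TopAlg.inr X B (v i).2))
    (T.op ω fun i => TopAlg.inr X B (v i).2)

theorem twist_mem (h : T.LoopAxioms plus minus) {X B : PAlg T} {n : ℕ} (ω : T.Op n)
    (v : Fin n → X × B) :
    TopAlg.desc (PAlg.zeroHom X B) (𝟙 B) (twist plus minus ω v) = T.zeroOf B := by
  have h0 : ∀ y : B, T.bin minus y y = T.zeroOf B := fun y => by
    have := h.add_sub B B.models (T.zeroOf B) y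
    rwa [h.zero_add B B.models] at this
  have e : ∀ i, TopAlg.desc (PAlg.zeroHom X B) (𝟙 B)
      (T.bin plus (TopAlg.inl X B (v i).1) (TopAlg.inr X B (v i).2)) = (v i).2 := fun i =>
    (map_bin _ plus _ _).trans (h.zero_add B B.models _)
  refine (map_bin _ minus _ _).trans ?_
  rw [TopAlg.Hom.map_op, TopAlg.Hom.map_op, funext e]
  exact h0 _

/-- The same element, as an element of the kernel `T^B(X)` of `[0, 1] : X + B ⟶ B`. -/
noncomputable def kerTwist (h : T.LoopAxioms plus minus) {X B : PAlg T} {n : ℕ} (ω : T.Op n)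
    (v : Fin n → X × B) : (PAlg.pointMonad B).obj X :=
  (⟨twist plus minus ω v, twist_mem h ω v⟩ : PAlg.ker (PAlg.freePt B X).p)

/-- The operations
`ω((x₁, b₁), …, (xₙ, bₙ)) = (ξ(ω(x₁ + b₁, …, xₙ + bₙ) - ω(b₁, …, bₙ)), ω(b₁, …, bₙ))` on `X × B`,
for a `T^B`-algebra `(X, ξ)`. -/
@[reducible]
noncomputable def semidirectStructure (h : T.LoopAxioms plus minus) {B : PAlg T}
    (X : (PAlg.pointMonad B).Algebra) : T.lang.Structure (X.A × B) :=
  T.mkStructure fun ω v => (X.a (kerTwist h ω v), T.op ω fun i => (v i).2)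

/-- The topological algebra on the product space `X × B` with the operations above, given that
they are continuous and satisfy the equations of the theory. -/
noncomputable def semidirectAlg (h : T.LoopAxioms plus minus) {B : PAlg T}
    (X : (PAlg.pointMonad B).Algebra)
    (hc : ∀ (n : ℕ) (ω : T.Op n), Continuous fun v : Fin n → X.A × B =>
      (semidirectStructure h X).funMap ω v)
    (hm : @AlgTheory.Models T.toAlgTheory (X.A × B) (semidirectStructure h X)) : PAlg T where
  carrier := X.A × B
  top := instTopologicalSpaceProd
  str := semidirectStructure h X
  continuous_op := hc
  models := hm

/-- The point over `B` formed by the algebra `X × B`, the projection `(x, b) ↦ b` and the section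
`b ↦ (0, b)`, given that the section is a homomorphism. -/
noncomputable def semidirectPt (h : T.LoopAxioms plus minus) {B : PAlg T}
    (X : (PAlg.pointMonad B).Algebra)
    (hc : ∀ (n : ℕ) (ω : T.Op n), Continuous fun v : Fin n → X.A × B =>
      (semidirectStructure h X).funMap ω v)
    (hm : @AlgTheory.Models T.toAlgTheory (X.A × B) (semidirectStructure h X))
    (hs : ∀ (n : ℕ) (ω : T.Op n) (b : Fin n → B), ((T.zeroOf X.A, T.op ω b) : X.A × B) =
      (semidirectStructure h X).funMap ω fun i => (T.zeroOf X.A, b i)) : Pt B where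
  obj := semidirectAlg h X hc hm
  p := { toFun := fun v : X.A × B => v.2
         continuous_toFun := continuous_snd
         map_op := fun _ _ _ => rfl }
  s := { toFun := fun b => ((T.zeroOf X.A, b) : X.A × B)
         continuous_toFun := Continuous.prodMk continuous_const continuous_id
         map_op := hs }
  s_p := rfl

/-- The element `(x, 0)` of the kernel of the projection `X × B ⟶ B`. -/
noncomputable def semidirectKer (h : T.LoopAxioms plus minus) {B : PAlg T}
    (X : (PAlg.pointMonad B).Algebra)
    (hc : ∀ (n : ℕ) (ω : T.Op n), Continuous fun v : Fin n → X.A × B =>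
      (semidirectStructure h X).funMap ω v)
    (hm : @AlgTheory.Models T.toAlgTheory (X.A × B) (semidirectStructure h X))
    (hs : ∀ (n : ℕ) (ω : T.Op n) (b : Fin n → B), ((T.zeroOf X.A, T.op ω b) : X.A × B) =
      (semidirectStructure h X).funMap ω fun i => (T.zeroOf X.A, b i)) (x : X.A) :
    ((PAlg.pointComparison B).obj (semidirectPt h X hc hm hs)).A :=
  (⟨((x, T.zeroOf B) : X.A × B), rfl⟩ : PAlg.ker (semidirectPt h X hc hm hs).p)

end Operations

end TopologicalVariety

/-! For a point `(A, p, s)`, the loop axioms make `a ↦ (a - s (p a), p a)` and `(k, b) ↦ k + s b`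
mutually inverse continuous maps between `A` and `ker p × B` (`Pt.toKer_add`, `Pt.toKer_add_s`,
`Pt.p_add_s`). The operations of `A` can be read off from the action of `T^B` on `ker p`: evaluating
the twisted operation in `A` gives the kernel component of `ω(a₁, …, aₙ)`
(`Pt.comparison_a_kerTwist`). Hence a morphism of points is the same as an algebra morphism between
the kernels, and the comparison functor is fully faithful.

Given an algebra `(X, ξ)`, let `q : X + B → X × B` send `z` to `(ξ(z - [0,1]z), [0,1]z)`. By the
unit law, the continuous map `σ(x, b) = x + b` is a section of `q`. The operations on `X × B` are `q
∘ ω ∘ σ` (`semidirectStructure_funMap`), hence continuous for the product topology. Associativity of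
`ξ` makes `q` compatible with the operations (`semidirectQuot_op`), so the equations descend from `X
+ B`. Restricted to `T^B(X)`, `q` is `(ξ, 0)`, which identifies the kernel algebra with `(X, ξ)`.
This gives essential surjectivity, so monadicity is proved directly, without a monadicity criterion.
-/

namespace TopologicalVariety

/-! ### Derived operations, transfer of equations, loop identities -/

theorem continuous_realize {T : AlgTheory.{u}} (A : TopAlg T) {α : Type v} (t : T.lang.Term α) :
    Continuous fun a : α → A => t.realize a := by
  induction t with
  | var i => exact continuous_apply i
  | func ω ts ih => exact (A.continuous_op _ ω).comp (continuous_pi ih)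

/-- A pointwise inverse of a homomorphism is a homomorphism. -/
theorem map_op_of_inverse {T : AlgTheory.{u}} {A C : TopAlg T} (f : A ⟶ C) (g : C → A)
    (hgf : ∀ a, g (f a) = a) (hfg : ∀ c, f (g c) = c) (n : ℕ) (ω : T.Op n) (c : Fin n → C) :
    g (T.op ω c) = T.op ω fun i => g (c i) := by
  rw [← hgf (T.op ω fun i => g (c i)), f.map_op]
  simp only [hfg]

/-- Equations are inherited along surjective homomorphisms. -/
theorem AlgTheory.Models.of_rightInverse {T : AlgTheory.{u}} {A C : Type u} [T.lang.Structure A]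
    [T.lang.Structure C] (hA : T.Models A) (f : A → C)
    (hf : ∀ (n : ℕ) (ω : T.Op n) (a : Fin n → A), f (T.op ω a) = T.op ω fun i => f (a i))
    (g : C → A) (hg : ∀ c, f (g c) = c) : T.Models C := by
  intro e he c
  have hc : c = fun i => f (g (c i)) := funext fun i => (hg _).symm
  rw [hc, ← realize_map T f hf, ← realize_map T f hf, hA e he]

variable {T : PointedTheory.{u}} {plus minus : T.lang.Term (Fin 2)}

theorem continuous_bin {Z : Type v} [TopologicalSpace Z] {A : PAlg T} (t : T.lang.Term (Fin 2))
    {f g : Z → A} (hf : Continuous f) (hg : Continuous g) :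
    Continuous fun z => T.bin t (f z) (g z) := by
  refine (continuous_realize A t).comp (continuous_pi fun i => ?_)
  fin_cases i
  · exact hf
  · exact hg

namespace PointedTheory.LoopAxioms

theorem sub_self (h : T.LoopAxioms plus minus) (A : PAlg T) (x : A) :
    T.bin minus x x = T.zeroOf A := by
  have := h.add_sub A A.models (T.zeroOf A) x
  rwa [h.zero_add A A.models] at this

theorem sub_zero (h : T.LoopAxioms plus minus) (A : PAlg T) (x : A) :
    T.bin minus x (T.zeroOf A) = x := by
  have := h.add_sub A A.models x (T.zeroOf A)
  rwa [h.add_zero A A.models] at this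

end PointedTheory.LoopAxioms

/-! ### Splitting a point into its kernel and its base -/

namespace Pt

variable {B : PAlg T}

theorem p_s (P : Pt B) (b : B) : P.p (P.s b) = b :=
  congrArg (fun φ : B ⟶ B => φ b) P.s_p

/-- The component `a - s (p a)` of an element of a point in the kernel of the projection. -/
noncomputable def toKer (h : T.LoopAxioms plus minus) (P : Pt B) (a : P.obj) : PAlg.ker P.p :=
  ⟨T.bin minus a (P.s (P.p a)), by rw [map_bin, p_s, h.sub_self]⟩

theorem toKer_val (h : T.LoopAxioms plus minus) (P : Pt B) (a : P.obj) :
    (toKer h P a).1 = T.bin minus a (P.s (P.p a)) := rfl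

theorem continuous_toKer (h : T.LoopAxioms plus minus) (P : Pt B) : Continuous (toKer h P) :=
  Continuous.subtype_mk (continuous_bin minus continuous_id
    (P.s.continuous_toFun.comp P.p.continuous_toFun)) _

theorem toKer_add (h : T.LoopAxioms plus minus) (P : Pt B) (a : P.obj) :
    T.bin plus (toKer h P a).1 (P.s (P.p a)) = a :=
  h.sub_add P.obj P.obj.models _ _

theorem toKer_of_ker (h : T.LoopAxioms plus minus) (P : Pt B) (a : PAlg.ker P.p) :
    toKer h P a.1 = a := by
  refine Subtype.ext ?_
  rw [toKer_val, a.2, PAlg.map_zero, h.sub_zero]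

theorem toKer_s (h : T.LoopAxioms plus minus) (P : Pt B) (b : B) :
    toKer h P (P.s b) = T.zeroOf (PAlg.ker P.p) := by
  refine Subtype.ext ?_
  rw [toKer_val, p_s, h.sub_self]
  exact (PAlg.map_zero (PAlg.kerι P.p)).symm

/-- Since `p (k + s b) = 0 + b = b`, the kernel component is `(k + s b) - s b`. -/
theorem toKer_add_s (h : T.LoopAxioms plus minus) (P : Pt B) (k : PAlg.ker P.p) (b : B) :
    toKer h P (T.bin plus k.1 (P.s b)) = k := by
  refine Subtype.ext ?_
  rw [toKer_val, map_bin, p_s, k.2, h.zero_add B B.models, h.add_sub P.obj P.obj.models]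

theorem p_add_s (h : T.LoopAxioms plus minus) (P : Pt B) (k : PAlg.ker P.p) (b : B) :
    P.p (T.bin plus k.1 (P.s b)) = b := by
  rw [map_bin, p_s, k.2, h.zero_add B B.models]

theorem map_s {P Q : Pt B} (f : P ⟶ Q) (b : B) : f.hom (P.s b) = Q.s b :=
  congrArg (fun φ : B ⟶ Q.obj => φ b) f.s_hom

/-- The action of the kernel of a point on a twisted operation. -/
theorem comparison_a_kerTwist (h : T.LoopAxioms plus minus) (P : Pt B) {n : ℕ} (ω : T.Op n)
    (a : Fin n → P.obj) :
    ((PAlg.pointComparison B).obj P).a (kerTwist h ω fun i => (toKer h P (a i), P.p (a i))) =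
      toKer h P (T.op ω a) := by
  refine Subtype.ext ?_
  -- The structure map on `ker p` is the restriction of the evaluation `X + B ⟶ A` with `X = ker p`.
  -- It turns each formal sum of components back into `a i`.
  change TopAlg.desc (PAlg.kerι P.p) P.s
    (twist plus minus ω fun i => (toKer h P (a i), P.p (a i))) = (toKer h P (T.op ω a)).1
  refine (map_bin _ minus _ _).trans ?_
  rw [TopAlg.Hom.map_op, TopAlg.Hom.map_op, toKer_val, P.p.map_op, P.s.map_op]
  refine congrArg (fun x => T.bin minus (T.op ω x) _) (funext fun i => ?_)
  exact (map_bin _ plus _ _).trans (toKer_add h P (a i))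

end Pt

/-! ### Full faithfulness of the comparison functor -/

namespace PAlg

variable {B : PAlg T}

/-- `T^B f` is a restriction of the homomorphism `f + 1_B`, which preserves derived operations. Used
for fullness and, with `f = ξ`, for `semidirectQuot_op`. -/
theorem map_kerTwist (h : T.LoopAxioms plus minus) {X Y : PAlg T} (f : X ⟶ Y) {n : ℕ}
    (ω : T.Op n) (v : Fin n → X × B) :
    (pointMonad B).map f (kerTwist h ω v) = kerTwist h ω fun i => (f (v i).1, (v i).2) := by
  refine Subtype.ext ?_
  change TopAlg.desc (f ≫ TopAlg.inl Y B) (TopAlg.inr Y B) (twist plus minus ω v) =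
    twist plus minus ω fun i => (f (v i).1, (v i).2)
  refine (map_bin _ minus _ _).trans ?_
  rw [TopAlg.Hom.map_op, TopAlg.Hom.map_op]
  refine congrArg (fun x => T.bin minus (T.op ω x) _) (funext fun i => ?_)
  exact map_bin _ plus _ _

/-- Every element is a sum `k + s b`, and the value on `s b` is forced. -/
theorem pointComparison_faithful (h : T.LoopAxioms plus minus) :
    (pointComparison B).Faithful where
  map_injective {P Q f g} hfg := by
    refine Pt.Hom.ext (TopAlg.hom_ext fun a => ?_)
    have hk : f.hom (P.toKer h a).1 = g.hom (P.toKer h a).1 :=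
      congrArg (fun φ : (pointComparison B).obj P ⟶ (pointComparison B).obj Q =>
        Subtype.val (p := fun a => Q.p a = T.zeroOf B) (φ.f (P.toKer h a))) hfg
    rw [← P.toKer_add h a, map_bin, map_bin, hk, Pt.map_s, Pt.map_s]

/-- The morphism of points with a given restriction to the kernels. -/
noncomputable def ptHomOfAlgebraHom (h : T.LoopAxioms plus minus) {P Q : Pt B}
    (g : (pointComparison B).obj P ⟶ (pointComparison B).obj Q) : P ⟶ Q where
  hom :=
    { toFun := fun a => T.bin plus (kerι Q.p (g.f (P.toKer h a))) (Q.s (P.p a))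
      continuous_toFun := continuous_bin plus
        ((kerι Q.p).continuous_toFun.comp
          (g.f.continuous_toFun.comp (P.continuous_toKer h)))
        (Q.s.continuous_toFun.comp P.p.continuous_toFun)
      map_op := fun n ω a => by
        -- It suffices to match kernel and base components. For the kernel component, both sides
        -- become actions on twisted operations, and the algebra-morphism square of `g` compares
        -- them.
        have hg : g.f (P.toKer h (T.op ω a)) = Q.toKer h (T.op ω fun i =>
            T.bin plus (kerι Q.p (g.f (P.toKer h (a i)))) (Q.s (P.p (a i)))) := by
          rw [← Pt.comparison_a_kerTwist, ← Pt.comparison_a_kerTwist]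
          refine (congrArg (fun φ : _ ⟶ _ => TopAlg.Hom.toFun φ
            (kerTwist h ω fun i => (P.toKer h (a i), P.p (a i)))) g.h).symm.trans ?_
          refine congrArg ((pointComparison B).obj Q).a.toFun ?_
          refine (map_kerTwist h g.f ω _).trans (congrArg (kerTwist h ω) (funext fun i => ?_))
          exact (Prod.ext (Q.toKer_add_s h _ _) (Q.p_add_s h _ _)).symm
        rw [hg]
        have hp : P.p (T.op ω a) = Q.p (T.op ω fun i =>
            T.bin plus (kerι Q.p (g.f (P.toKer h (a i)))) (Q.s (P.p (a i)))) := by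
          rw [P.p.map_op, Q.p.map_op]
          exact congrArg _ (funext fun i => (Q.p_add_s h _ _).symm)
        rw [hp]
        exact Q.toKer_add h _ }
  hom_p := TopAlg.hom_ext fun a => Q.p_add_s h _ _
  s_hom := TopAlg.hom_ext fun b => by
    -- Viewing the kernel map followed by the inclusion as one morphism lets `map_zero` apply.
    let g' : ker P.p ⟶ ker Q.p := g.f
    change T.bin plus ((g' ≫ kerι Q.p) (P.toKer h (P.s b))) (Q.s (P.p (P.s b))) = Q.s b
    rw [P.toKer_s, P.p_s, map_zero, h.zero_add Q.obj Q.obj.models]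

theorem pointComparison_full (h : T.LoopAxioms plus minus) : (pointComparison B).Full where
  map_surjective {P Q} g := by
    refine ⟨ptHomOfAlgebraHom h g, Monad.Algebra.Hom.ext (TopAlg.hom_ext fun k => ?_)⟩
    refine Subtype.ext ?_
    let g' : ker P.p ⟶ ker Q.p := g.f
    let k' : ker P.p := k
    change T.bin plus ((g' ≫ kerι Q.p) (P.toKer h k'.1)) (Q.s (P.p k'.1)) = (g' ≫ kerι Q.p) k'
    -- For `k` in the kernel the base component vanishes, so the extension is `g k + s 0 = g k`.
    rw [P.toKer_of_ker, k'.2, map_zero, h.add_zero Q.obj Q.obj.models]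

end PAlg

/-! ### The product `X × B` as a retract of `X + B` -/

section Semidirect

variable (h : T.LoopAxioms plus minus) {B : PAlg T} (X : (PAlg.pointMonad B).Algebra)

/-- The quotient map `z ↦ (ξ (z - [0, 1] z), [0, 1] z)` from `X + B` to `X × B`. -/
noncomputable def semidirectQuot (z : TopAlg.coprod X.A B) : X.A × B :=
  (X.a ((PAlg.freePt B X.A).toKer h z), (PAlg.freePt B X.A).p z)

/-- The map `(x, b) ↦ x + b` from `X × B` to `X + B`. -/
noncomputable def semidirectSection (v : X.A × B) : TopAlg.coprod X.A B :=
  T.bin plus (TopAlg.inl X.A B v.1) (TopAlg.inr X.A B v.2)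

theorem continuous_semidirectQuot : Continuous (semidirectQuot h X) :=
  (X.a.continuous_toFun.comp ((PAlg.freePt B X.A).continuous_toKer h)).prodMk
    (PAlg.freePt B X.A).p.continuous_toFun

theorem continuous_semidirectSection :
    Continuous (semidirectSection (plus := plus) X) :=
  continuous_bin plus ((TopAlg.inl X.A B).continuous_toFun.comp continuous_fst)
    ((TopAlg.inr X.A B).continuous_toFun.comp continuous_snd)

/-- This is the unit law: the unit of `T^B` at `X` is the corestriction of `ι_X`. -/
theorem algebra_a_unit (x : X.A) :
    X.a ((⟨TopAlg.inl X.A B x, rfl⟩ : PAlg.ker (PAlg.freePt B X.A).p)) = x :=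
  congrArg (fun φ : X.A ⟶ X.A => φ x) X.unit

theorem semidirectQuot_section (v : X.A × B) :
    semidirectQuot h X (semidirectSection (plus := plus) X v) = v := by
  refine Prod.ext ?_ ?_
  · refine Eq.trans ?_ (algebra_a_unit X v.1)
    exact congrArg X.a.toFun ((PAlg.freePt B X.A).toKer_add_s h ⟨TopAlg.inl X.A B v.1, rfl⟩ v.2)
  · exact (PAlg.freePt B X.A).p_add_s h ⟨TopAlg.inl X.A B v.1, rfl⟩ v.2

/-- The subtracted term `ω(b₁, …, bₙ)` is `ι_B [0,1]` of `ω(x₁ + b₁, …, xₙ + bₙ)`, so the argument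
of `ξ` is the kernel component of the latter. In this form continuity is immediate. -/
theorem semidirectStructure_funMap {n : ℕ} (ω : T.Op n) (v : Fin n → X.A × B) :
    (semidirectStructure h X).funMap ω v =
      semidirectQuot h X (T.op ω fun i => semidirectSection (plus := plus) X (v i)) := by
  have hp : (PAlg.freePt B X.A).p (T.op ω fun i => semidirectSection (plus := plus) X (v i)) =
      T.op ω fun i => (v i).2 := by
    refine ((PAlg.freePt B X.A).p.map_op n ω _).trans (congrArg _ (funext fun i => ?_))
    exact (PAlg.freePt B X.A).p_add_s h ⟨TopAlg.inl X.A B (v i).1, rfl⟩ (v i).2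
  refine Prod.ext (congrArg X.a.toFun (Subtype.ext ?_)) hp.symm
  change T.bin minus _ (T.op ω fun i => TopAlg.inr X.A B (v i).2) = T.bin minus _ _
  exact congrArg (T.bin minus _) (((TopAlg.inr X.A B).map_op n ω _).symm.trans
    (congrArg (TopAlg.inr X.A B).toFun hp.symm))

/-- This is where associativity of `ξ` enters: the operations `q ∘ ω ∘ σ` replace each `z i` by `σ
(q (z i))`, and `ξ` does not see the change. -/
theorem semidirectQuot_op (n : ℕ) (ω : T.Op n) (z : Fin n → TopAlg.coprod X.A B) :
    semidirectQuot h X (T.op ω z) =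
      (semidirectStructure h X).funMap ω fun i => semidirectQuot h X (z i) := by
  refine Prod.ext ?_ ((PAlg.freePt B X.A).p.map_op n ω z)
  let P := PAlg.freePt B X.A
  -- The kernel algebra of the free point is the free algebra, so the kernel component of `ω(z)` is
  -- the monad multiplication applied to a twisted operation. Then `ξ ∘ μ = ξ ∘ T^B ξ`, and
  -- naturality moves `ξ` inside.
  refine (congrArg X.a.toFun (P.comparison_a_kerTwist h ω z).symm).trans ?_
  refine (congrArg (fun φ : _ ⟶ X.A => φ (kerTwist h ω fun i => (P.toKer h (z i), P.p (z i))))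
    X.assoc).trans ?_
  exact congrArg X.a.toFun (PAlg.map_kerTwist h X.a ω _)

theorem continuous_semidirectStructure (n : ℕ) (ω : T.Op n) :
    Continuous fun v : Fin n → X.A × B => (semidirectStructure h X).funMap ω v := by
  simp only [semidirectStructure_funMap]
  exact (continuous_semidirectQuot h X).comp (((TopAlg.coprod X.A B).continuous_op n ω).comp
    (continuous_pi fun i => (continuous_semidirectSection X).comp (continuous_apply i)))

theorem semidirectStructure_models :
    @AlgTheory.Models T.toAlgTheory (X.A × B) (semidirectStructure h X) :=
  letI := semidirectStructure h X
  AlgTheory.Models.of_rightInverse (TopAlg.coprod X.A B).models (semidirectQuot h X)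
    (semidirectQuot_op h X) _ (semidirectQuot_section h X)

theorem semidirectQuot_inr (b : B) :
    semidirectQuot h X (TopAlg.inr X.A B b) = (T.zeroOf X.A, b) :=
  Prod.ext ((congrArg X.a.toFun ((PAlg.freePt B X.A).toKer_s h b)).trans (PAlg.map_zero X.a)) rfl

/-- Elements of `T^B(X)` are their own kernel components. This recovers `ξ` from `q`. -/
theorem semidirectQuot_of_ker (w : PAlg.ker (PAlg.freePt B X.A).p) :
    semidirectQuot h X w.1 = (X.a w, T.zeroOf B) :=
  Prod.ext (congrArg X.a.toFun ((PAlg.freePt B X.A).toKer_of_ker h w)) w.2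

theorem semidirectQuot_inl (x : X.A) :
    semidirectQuot h X (TopAlg.inl X.A B x) = (x, T.zeroOf B) := by
  refine (semidirectQuot_of_ker h X ⟨TopAlg.inl X.A B x, rfl⟩).trans ?_
  rw [algebra_a_unit]

theorem semidirectStructure_section (n : ℕ) (ω : T.Op n) (b : Fin n → B) :
    ((T.zeroOf X.A, T.op ω b) : X.A × B) =
      (semidirectStructure h X).funMap ω fun i => (T.zeroOf X.A, b i) := by
  -- The section is `q ∘ ι_B`, a composite of maps preserving the operations.
  rw [← semidirectQuot_inr h X, TopAlg.Hom.map_op, semidirectQuot_op]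
  simp only [semidirectQuot_inr]

/-! ### The semidirect product and its kernel algebra -/

/-- The point `X × B` over `B`. -/
noncomputable abbrev semidirectProduct : Pt B :=
  semidirectPt h X (continuous_semidirectStructure h X) (semidirectStructure_models h X)
    (semidirectStructure_section h X)

/-- The quotient map from `X + B` to `X × B`, as a morphism. -/
noncomputable def semidirectQuotHom : TopAlg.coprod X.A B ⟶ (semidirectProduct h X).obj where
  toFun := semidirectQuot h X
  continuous_toFun := continuous_semidirectQuot h X
  map_op := semidirectQuot_op h X

/-- The morphism `x ↦ (x, 0)` to the kernel of the projection of `X × B`. -/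
noncomputable def semidirectKerHom : X.A ⟶ PAlg.ker (semidirectProduct h X).p :=
  -- Defined as `q ∘ ι_X`, so that it is a morphism by construction; its values come from
  -- `semidirectQuot_inl`.
  PAlg.kerLift _ (TopAlg.inl X.A B ≫ semidirectQuotHom h X) fun _ => rfl

theorem semidirectKerHom_apply (x : X.A) :
    semidirectKerHom h X x = semidirectKer h X (continuous_semidirectStructure h X)
      (semidirectStructure_models h X) (semidirectStructure_section h X) x :=
  Subtype.ext (semidirectQuot_inl h X x)

/-- The first projection on the kernel of the projection of `X × B`. -/
noncomputable def semidirectKerFst (k : PAlg.ker (semidirectProduct h X).p) : X.A :=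
  Prod.fst (show X.A × B from k.1)

theorem semidirectKerFst_hom (x : X.A) : semidirectKerFst h X (semidirectKerHom h X x) = x :=
  congrArg Prod.fst (semidirectQuot_inl h X x)

theorem semidirectKerHom_fst (k : PAlg.ker (semidirectProduct h X).p) :
    semidirectKerHom h X (semidirectKerFst h X k) = k :=
  Subtype.ext ((semidirectQuot_inl h X _).trans (Prod.ext rfl k.2.symm))

/-- The isomorphism of algebras `x ↦ (x, 0)` onto the kernel of the projection of `X × B`. -/
noncomputable def semidirectKerIso :
    X.A ≅ ((PAlg.pointComparison B).obj (semidirectProduct h X)).A where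
  hom := semidirectKerHom h X
  inv :=
    { toFun := semidirectKerFst h X
      continuous_toFun := continuous_fst.comp continuous_subtype_val
      -- The operations are twisted in the first coordinate, so compatibility is obtained from being
      -- inverse to a homomorphism.
      map_op := map_op_of_inverse (semidirectKerHom h X) _ (semidirectKerFst_hom h X)
        (semidirectKerHom_fst h X) }
  hom_inv_id := TopAlg.hom_ext (semidirectKerFst_hom h X)
  inv_hom_id := TopAlg.hom_ext (semidirectKerHom_fst h X)

/-- The composite `X + B ⟶ ker + B ⟶ X × B` agrees with `q` on both summands, hence equals `q`; on
`T^B(X)` this is `(ξ, 0)`. -/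
theorem semidirectKerHom_a (w : PAlg.ker (PAlg.freePt B X.A).p) :
    ((PAlg.pointComparison B).obj (semidirectProduct h X)).a
        ((PAlg.pointMonad B).map (semidirectKerHom h X) w) =
      semidirectKerHom h X (X.a w) := by
  refine Subtype.ext ?_
  have hq : TopAlg.desc (semidirectKerHom h X ≫ TopAlg.inl _ B) (TopAlg.inr _ B) ≫
      TopAlg.desc (PAlg.kerι (semidirectProduct h X).p) (semidirectProduct h X).s =
      semidirectQuotHom h X :=
    TopAlg.coprod_hom_ext (fun _ => rfl) fun b => (semidirectQuot_inr h X b).symm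
  refine (congrArg (fun φ : TopAlg.coprod X.A B ⟶ _ => φ w.1) hq).trans ?_
  exact (semidirectQuot_of_ker h X w).trans (semidirectQuot_inl h X _).symm

/-- The isomorphism from a `T^B`-algebra to the image of `X × B` under the comparison functor. -/
noncomputable def semidirectIso :
    X ≅ (PAlg.pointComparison B).obj (semidirectProduct h X) :=
  Monad.Algebra.isoMk (semidirectKerIso h X) (TopAlg.hom_ext (semidirectKerHom_a h X))

end Semidirect

/-! ### Monadicity and uniqueness -/

theorem PAlg.pointComparison_isEquivalence (h : T.LoopAxioms plus minus) (B : PAlg T) :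
    (pointComparison B).IsEquivalence where
  faithful := pointComparison_faithful h
  full := pointComparison_full h
  essSurj := ⟨fun X => ⟨semidirectProduct h X, ⟨(semidirectIso h X).symm⟩⟩⟩

/-- A fully faithful functor lifts isomorphisms between images, so points with isomorphic kernel
algebras are isomorphic. -/
theorem isSemidirectProduct_iff (h : T.LoopAxioms plus minus) {B : PAlg T}
    (X : (PAlg.pointMonad B).Algebra) (P : Pt B) :
    IsSemidirectProduct X P ↔ Nonempty (P ≅ semidirectProduct h X) := by
  have := PAlg.pointComparison_isEquivalence h B
  constructor
  · rintro ⟨i⟩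
    exact ⟨(PAlg.pointComparison B).preimageIso (i ≪≫ semidirectIso h X)⟩
  · rintro ⟨i⟩
    exact ⟨(PAlg.pointComparison B).mapIso i ≪≫ (semidirectIso h X).symm⟩

end TopologicalVariety

theorem mainTheorem1 (T : TopologicalVariety.PointedTheory.{u}) (plus minus : T.lang.Term (Fin 2))
    (h : T.LoopAxioms plus minus) :
    TopologicalVariety.HasSemidirectProducts T ∧
    ∀ (B : TopologicalVariety.PAlg T)
      (X : (TopologicalVariety.PAlg.pointMonad B).Algebra),
      ∃ (hc : ∀ (n : ℕ) (ω : T.Op n), Continuous fun v : Fin n → X.A × B =>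
          (TopologicalVariety.semidirectStructure h X).funMap ω v)
        (hm : @TopologicalVariety.AlgTheory.Models T.toAlgTheory (X.A × B)
          (TopologicalVariety.semidirectStructure h X))
        (hs : ∀ (n : ℕ) (ω : T.Op n) (b : Fin n → B),
          ((T.zeroOf X.A, T.op ω b) : X.A × B) =
            (TopologicalVariety.semidirectStructure h X).funMap ω
              fun i => (T.zeroOf X.A, b i)),
        (∃ e : X ≅ (TopologicalVariety.PAlg.pointComparison B).obj
            (TopologicalVariety.semidirectPt h X hc hm hs),
          ∀ x : X.A, e.hom.f x = TopologicalVariety.semidirectKer h X hc hm hs x) ∧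
        ∀ P : TopologicalVariety.Pt B, TopologicalVariety.IsSemidirectProduct X P ↔
          Nonempty (P ≅ TopologicalVariety.semidirectPt h X hc hm hs) := by
  refine ⟨TopologicalVariety.PAlg.pointComparison_isEquivalence h, fun B X =>
    ⟨TopologicalVariety.continuous_semidirectStructure h X,
      TopologicalVariety.semidirectStructure_models h X,
      TopologicalVariety.semidirectStructure_section h X,
      ⟨TopologicalVariety.semidirectIso h X, TopologicalVariety.semidirectKerHom_apply h X⟩,
      TopologicalVariety.isSemidirectProduct_iff h X⟩⟩
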